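/- Let $\mathbf K([0,1])$ be the space of compact subsets of $[0,1]$ (including $\emptyset$) with the Vietoris topology. For $A\in\mathbf K([0,1])$ let $\dim_H(A)$ be its Hausdorff dimension, and let its Fourier dimension be $$\dim_F(A)=\sup\{s\in[0,1] : \exists \mu\in\mathbb P(A)\ \exists c>0\ \forall x\in\mathbb R\setminus\{0\}\ \ |\hat\mu(x)|\le c\,|x|^{-s/2}\},$$ where $\mathbb P(A)$ is the set of Borel probability measures $\mu$ on $\mathbb R$ with $\mu(A)=1$, $\hat\mu(x)=\int_{\mathbb R} e^{-ixt}\,d\mu(t)$, and $\sup\emptyset=0$. Call $A$ a Salem set if $\dim_H(A)=\dim_F(A)$, and then write $\dim(A)$ for the common value; let $\mathscr S([0,1])\subseteq\mathbf K([0,1])$ be the family of closed Salem subsets of $[0,1]$, with the subspace topology. In a topological space, let $\boldsymbol\Sigma^0_1$ be the class of open sets, $\boldsymbol\Pi^0_n$ the class of complements of $\boldsymbol\Sigma^0_n$ sets, and, for $n>1$, $\boldsymbol\Sigma^0_n$ the class of countable unions of sets each of which is $\boldsymbol\Pi^0_m$ for some $1\le m<n$. Then: 1. $\{(A,p)\in\mathbf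 K([0,1])\times[0,1] : \dim_H(A)>p\}$ is $\boldsymbol\Sigma^0_2$, and $\{(A,p)\in\mathbf K([0,1])\times[0,1] : \dim_H(A)\ge p\}$ is $\boldsymbol\Pi^0_3$, in $\mathbf K([0,1])\times[0,1]$. 2. $\{(A,p)\in\mathbf K([0,1])\times[0,1] : \dim_F(A)>p\}$ is $\boldsymbol\Sigma^0_2$, and $\{(A,p)\in\mathbf K([0,1])\times[0,1] : \dim_F(A)\ge p\}$ is $\boldsymbol\Pi^0_3$, in $\mathbf K([0,1])\times[0,1]$. 3. $\mathscr S([0,1])$ is $\boldsymbol\Pi^0_3$ in $\mathbf K([0,1])$. 4. $\{(A,p)\in\mathscr S([0,1])\times[0,1] : \dim(A)>p\}$ is $\boldsymbol\Sigma^0_2$, and $\{(A,p)\in\mathscr S([0,1])\times[0,1] : \dim(A)\ge p\}$ is $\boldsymbol\Pi^0_3$, in $\mathscr S([0,1])\times[0,1]$. -/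

import Mathlib

open scoped NNReal ENNReal

/-- `BorelSigma n S`: the subset `S` of the topological space `X` belongs to the (boldface) class
`Σ⁰_n(X)` of the Borel hierarchy, for a finite level `n ≥ 1`: the `Σ⁰_1` sets are the open sets and,
for `n > 1`, the `Σ⁰_n` sets are the countable unions `⋃ k, A k` where each `A k` is `Π⁰_{m k}`
(that is, its complement is `Σ⁰_{m k}`) for some `1 ≤ m k < n`. -/
inductive BorelSigma {X : Type*} [TopologicalSpace X] : ℕ → Set X → Prop
  | of_isOpen (U : Set X) (hU : IsOpen U) : BorelSigma 1 U
  | iUnion (n : ℕ) (hn : 1 < n) (m : ℕ → ℕ) (A : ℕ → Set X) (hm : ∀ k, 1 ≤ m k ∧ m k < n)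
      (hA : ∀ k, BorelSigma (m k) (A k)ᶜ) : BorelSigma n (⋃ k, A k)

/-- `BorelPi n S`: the subset `S` of `X` belongs to the class `Π⁰_n(X)`, i.e. its complement
belongs to `Σ⁰_n(X)`. -/
def BorelPi {X : Type*} [TopologicalSpace X] (n : ℕ) (S : Set X) : Prop :=
  BorelSigma n Sᶜ

/-- The Fourier transform `μ̂(ξ) = ∫ exp(-i ξ x) dμ(x)` of a measure on the real line. -/
noncomputable def fourierTransformMeasure (μ : MeasureTheory.Measure ℝ) (ξ : ℝ) : ℂ :=
  ∫ x : ℝ, Complex.exp (-(Complex.I * (ξ : ℂ) * (x : ℂ))) ∂μ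

/-- `FourierDecay A s`: some Borel probability measure `μ` on `ℝ` with `μ(A) = 1` satisfies
`|μ̂(x)| ≤ c |x|^(-s/2)` for some constant `c > 0` and all real `x ≠ 0`. (At `x = 0` the bound is
void when `s > 0`, the right-hand side being infinite, and is `1 ≤ c` when `s = 0`.) -/
def FourierDecay (A : Set ℝ) (s : ℝ≥0) : Prop :=
  ∃ μ : MeasureTheory.Measure ℝ, MeasureTheory.IsProbabilityMeasure μ ∧ μ A = 1 ∧
    ∃ c : ℝ, 0 < c ∧
      ∀ x : ℝ, x ≠ 0 → ‖fourierTransformMeasure μ x‖ ≤ c * |x| ^ (-(s : ℝ) / 2)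

/-- The Fourier dimension of `A ⊆ ℝ`: the supremum of all `s ∈ [0, 1]` with `FourierDecay A s`
(and `0` if there is no such `s`, i.e. for `A = ∅`). -/
noncomputable def fourierDim (A : Set ℝ) : ℝ≥0∞ :=
  ⨆ (s : ℝ≥0) (_ : s ≤ 1 ∧ FourierDecay A s), (s : ℝ≥0∞)

/-- The hyperspace of compact subsets of `[0,1]`. Mathlib equips `TopologicalSpace.Compacts`
with the Vietoris topology. -/
abbrev HyperUnit : Type := TopologicalSpace.Compacts (Set.Icc (0 : ℝ) 1)

/-- A compact subset of `[0,1]`, viewed as a subset of `ℝ`. -/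
def HyperUnit.toSet (A : HyperUnit) : Set ℝ :=
  ((↑) : Set.Icc (0 : ℝ) 1 → ℝ) '' (A : Set (Set.Icc (0 : ℝ) 1))

/-- The Hausdorff dimension of a compact subset of `[0,1]`. -/
noncomputable def HyperUnit.hausdorffDim (A : HyperUnit) : ℝ≥0∞ :=
  dimH A.toSet

/-- The Fourier dimension of a compact subset of `[0,1]`. -/
noncomputable def HyperUnit.fourierDim (A : HyperUnit) : ℝ≥0∞ :=
  _root_.fourierDim A.toSet

/-- The family of closed Salem subsets of `[0,1]`: those whose Hausdorff and Fourier dimensions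
are equal. -/
def salemSets : Set HyperUnit :=
  {A | A.hausdorffDim = A.fourierDim}

/-- The dimension of a closed Salem subset of `[0,1]`: the common value of its Hausdorff and
Fourier dimensions. -/
noncomputable def salemDim (A : salemSets) : ℝ≥0∞ :=
  A.1.hausdorffDim

/-! Everything reduces to one fact: for both dimensions, the sublevel sets `{A | dim A ≤ r}` are Gδ
in the hyperspace. Inserting rationals between values then gives all the stated classes.

For `dimH`, the condition is nullity of `μH[q]` for every rational `q > r`. Nullity means having
open covers of arbitrarily small `q`-sum, and `A ⊆ U` is a Vietoris-open condition on `A`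
(`HyperUnit.isGδ_hausdorffMeasure_eq_zero`).

For the Fourier dimension, decay with a fixed constant is a closed condition on pairs (set,
measure). Probability measures on `[0,1]` form a compact space, so its projection is closed; the
union over integer constants is Fσ, and failure of decay is Gδ (`HyperUnit.isGδ_not_fourierDecay`).
-/

open Set Filter Topology MeasureTheory TopologicalSpace

/-! ### Borel classes from Gδ sublevel sets -/

section Borel

variable {X Y : Type*} [TopologicalSpace X] [TopologicalSpace Y]

theorem borelSigma_two_of_isGδ_compl {S : Set X} (h : IsGδ Sᶜ) : BorelSigma 2 S := by
  obtain ⟨f, hf, hS⟩ := isGδ_iff_eq_iInter_nat.1 h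
  have hS' : S = ⋃ n, (f n)ᶜ := by rw [← compl_compl S, hS, compl_iInter]
  rw [hS']
  refine .iUnion 2 one_lt_two (fun _ => 1) _ (fun _ => ⟨le_rfl, one_lt_two⟩) fun k => ?_
  rw [compl_compl]
  exact .of_isOpen _ (hf k)

theorem borelSigma_three_iUnion {ι : Type*} [Countable ι] [Nonempty ι] {A : ι → Set X}
    (h : ∀ i, IsGδ (A i)) : BorelSigma 3 (⋃ i, A i) := by
  obtain ⟨e, he⟩ := exists_surjective_nat ι
  rw [← he.iUnion_comp]
  refine .iUnion 3 (by norm_num) (fun _ => 2) _ (fun _ => ⟨by norm_num, by norm_num⟩) fun k => ?_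
  exact borelSigma_two_of_isGδ_compl (by simpa using h (e k))

/-- Each complement is a countable union of closed sets, which are Gδ by metrizability. -/
theorem borelSigma_three_iUnion_inter_compl [MetrizableSpace X] {ι : Type*} [Countable ι]
    [Nonempty ι] {A B : ι → Set X} (hA : ∀ i, IsGδ (A i)) (hB : ∀ i, IsGδ (B i)) :
    BorelSigma 3 (⋃ i, A i ∩ (B i)ᶜ) := by
  let := metrizableSpaceMetric X
  choose f hf hS using fun i => isGδ_iff_eq_iInter_nat.1 (hB i)
  have : (⋃ i, A i ∩ (B i)ᶜ) = ⋃ p : ι × ℕ, A p.1 ∩ (f p.1 p.2)ᶜ := by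
    rw [iUnion_prod']
    refine iUnion_congr fun i => ?_
    rw [hS i, compl_iInter, inter_iUnion]
  rw [this]
  exact borelSigma_three_iUnion fun p => (hA p.1).inter (hf p.1 p.2).isClosed_compl.isGδ

theorem ENNReal.exists_rat_ofReal_btwn {a b : ℝ≥0∞} (h : a < b) :
    ∃ q : ℚ, a < ENNReal.ofReal q ∧ ENNReal.ofReal q < b := by
  obtain ⟨q, -, h₁, h₂⟩ := ENNReal.lt_iff_exists_rat_btwn.1 h
  exact ⟨q, h₁, h₂⟩

/-- If all sublevel sets of `f` are `Gδ`, then its strict hypograph is `Σ⁰_2`. -/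
theorem borelSigma_two_lt {f : X → ℝ≥0∞} {g : Y → ℝ≥0∞} (hf : ∀ r, IsGδ {x | f x ≤ r})
    (hg : Continuous g) : BorelSigma 2 {q : X × Y | g q.2 < f q.1} := by
  apply borelSigma_two_of_isGδ_compl
  have : {q : X × Y | g q.2 < f q.1}ᶜ =
      ⋂ r : ℚ, ({q | ENNReal.ofReal r < g q.2} ∪ {q | f q.1 ≤ ENNReal.ofReal r}) := by
    ext ⟨x, y⟩
    simp only [mem_compl_iff, mem_ofPred_eq, not_lt, mem_iInter, mem_union]
    refine ⟨fun h r => (lt_or_ge _ _).imp_right h.trans, fun h => ?_⟩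
    by_contra! hlt
    obtain ⟨r, h₁, h₂⟩ := ENNReal.exists_rat_ofReal_btwn hlt
    exact (h r).elim (fun h => h.not_gt h₁) fun h => h.not_gt h₂
  rw [this]
  exact .iInter fun r => (isOpen_lt continuous_const (hg.comp continuous_snd)).isGδ.union
    (IsGδ.preimage (f := Prod.fst) continuous_fst (hf (ENNReal.ofReal r)))

/-- If all sublevel sets of `f` are `Gδ`, then its hypograph is `Π⁰_3`. -/
theorem borelPi_three_le {f : X → ℝ≥0∞} {g : Y → ℝ≥0∞} (hf : ∀ r, IsGδ {x | f x ≤ r})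
    (hg : Continuous g) : BorelPi 3 {q : X × Y | g q.2 ≤ f q.1} := by
  have : {q : X × Y | g q.2 ≤ f q.1}ᶜ =
      ⋃ r : ℚ, ({q | ENNReal.ofReal r < g q.2} ∩ {q | f q.1 ≤ ENNReal.ofReal r}) := by
    ext ⟨x, y⟩
    simp only [mem_compl_iff, mem_ofPred_eq, not_le, mem_iUnion, mem_inter_iff]
    refine ⟨fun h => ?_, fun ⟨r, h₁, h₂⟩ => h₂.trans_lt h₁⟩
    obtain ⟨r, h₁, h₂⟩ := ENNReal.exists_rat_ofReal_btwn h
    exact ⟨r, h₂, h₁.le⟩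
  rw [BorelPi, this]
  exact borelSigma_three_iUnion fun r =>
    (isOpen_lt continuous_const (hg.comp continuous_snd)).isGδ.inter
      (IsGδ.preimage (f := Prod.fst) continuous_fst (hf (ENNReal.ofReal r)))

/-- The equalizer of two functions whose sublevel sets are `Gδ` is `Π⁰_3`. -/
theorem borelPi_three_eq [MetrizableSpace X] {f g : X → ℝ≥0∞} (hf : ∀ r, IsGδ {x | f x ≤ r})
    (hg : ∀ r, IsGδ {x | g x ≤ r}) : BorelPi 3 {x | f x = g x} := by
  -- Unequal values are separated by a rational; the Boolean records which function is the smaller.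
  have : {x | f x = g x}ᶜ = ⋃ p : ℚ × Bool,
      {x | cond p.2 (f x) (g x) ≤ ENNReal.ofReal p.1} ∩
        {x | cond p.2 (g x) (f x) ≤ ENNReal.ofReal p.1}ᶜ := by
    ext x
    simp only [mem_compl_iff, mem_ofPred_eq, mem_iUnion, mem_inter_iff, Prod.exists, Bool.exists_bool,
      cond_true, cond_false, not_le]
    constructor
    · intro h
      rcases lt_or_gt_of_ne h with h | h <;>
      obtain ⟨r, h₁, h₂⟩ := ENNReal.exists_rat_ofReal_btwn h
      · exact ⟨r, .inr ⟨h₁.le, h₂⟩⟩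
      · exact ⟨r, .inl ⟨h₁.le, h₂⟩⟩
    · rintro ⟨r, ⟨h₁, h₂⟩ | ⟨h₁, h₂⟩⟩
      · exact (h₁.trans_lt h₂).ne'
      · exact (h₁.trans_lt h₂).ne
  rw [BorelPi, this]
  refine borelSigma_three_iUnion_inter_compl ?_ ?_
  · rintro ⟨r, _ | _⟩ <;> simp [hf, hg]
  · rintro ⟨r, _ | _⟩ <;> simp [hf, hg]

end Borel

/-! ### Hausdorff dimension -/

section Hausdorff

theorem HyperUnit.isOpen_toSet_subset {U : Set ℝ} (hU : IsOpen U) :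
    IsOpen {A : HyperUnit | A.toSet ⊆ U} := by
  simp only [HyperUnit.toSet, image_subset_iff]
  exact Compacts.isOpen_subsets_of_isOpen (hU.preimage continuous_subtype_val)

/-- A set can be enlarged to an open set increasing the `s`-th power of its diameter by
arbitrarily little. -/
theorem exists_isOpen_superset_ediam_rpow_lt {X : Type*} [PseudoEMetricSpace X] {s : ℝ}
    (hs : 0 < s) (t : Set X) (ht : Metric.ediam t ≠ ∞) {ε : ℝ≥0∞} (hε : ε ≠ 0) :
    ∃ U, IsOpen U ∧ t ⊆ U ∧ Metric.ediam U ^ s ≤ Metric.ediam t ^ s + ε := by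
  have hc : Tendsto (fun δ : ℝ => (Metric.ediam t + 2 * ENNReal.ofReal δ) ^ s) (𝓝[>] 0)
      (𝓝 (Metric.ediam t ^ s)) := by
    have h : Continuous fun δ : ℝ => (Metric.ediam t + 2 * ENNReal.ofReal δ) ^ s :=
      (ENNReal.continuous_rpow_const).comp <| continuous_const.add <|
        (ENNReal.continuous_const_mul (by simp)).comp ENNReal.continuous_ofReal
    simpa using (h.tendsto 0).mono_left nhdsWithin_le_nhds
  have hlt : Metric.ediam t ^ s < Metric.ediam t ^ s + ε :=
    ENNReal.lt_add_right (ENNReal.rpow_ne_top_of_nonneg hs.le ht) hε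
  obtain ⟨δ, h₁, h₂⟩ := ((hc.eventually_lt_const hlt).and self_mem_nhdsWithin).exists
  refine ⟨Metric.thickening δ t, Metric.isOpen_thickening, Metric.self_subset_thickening h₂ t, ?_⟩
  refine le_trans ?_ h₁.le
  gcongr
  have := Metric.ediam_thickening_le (s := t) δ.toNNReal
  rw [Real.coe_toNNReal _ (le_of_lt h₂)] at this
  exact this

/-- No mesh condition is needed: as `s > 0`, a small sum already forces every diameter to be small.
-/
theorem hausdorffMeasure_eq_zero_iff {X : Type*} [EMetricSpace X] [MeasurableSpace X]
    [BorelSpace X] {s : ℝ} (hs : 0 < s) (A : Set X) :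
    μH[s] A = 0 ↔ ∀ n : ℕ, ∃ U : ℕ → Set X, (∀ i, IsOpen (U i)) ∧
      ∑' i, Metric.ediam (U i) ^ s < (n : ℝ≥0∞)⁻¹ ∧ A ⊆ ⋃ i, U i := by
  constructor
  · intro h n
    have hpos : (0 : ℝ≥0∞) < (n : ℝ≥0∞)⁻¹ := by simp
    rw [Measure.hausdorffMeasure_apply] at h
    simp only [ENNReal.iSup_eq_zero] at h
    have h1 := h 1 one_pos
    obtain ⟨ε, hε, hεn⟩ := exists_between hpos
    have h2 : 0 < (n : ℝ≥0∞)⁻¹ - ε := tsub_pos_of_lt hεn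
    have h3 := h1.trans_lt h2
    simp only [iInf_lt_iff] at h3
    obtain ⟨t, htA, htd, hsum⟩ := h3
    obtain ⟨δ, hδ, hδs⟩ := ENNReal.exists_pos_sum_of_countable' hε.ne' ℕ
    choose U hUo hU hUd using fun i => exists_isOpen_superset_ediam_rpow_lt hs (t i)
      ((htd i).trans_lt ENNReal.one_lt_top).ne (hδ i).ne'
    refine ⟨U, hUo, ?_, htA.trans (iUnion_mono hU)⟩
    have heq : ∀ i, (⨆ _ : (t i).Nonempty, Metric.ediam (t i) ^ s) = Metric.ediam (t i) ^ s := by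
      intro i
      rcases (t i).eq_empty_or_nonempty with h | h
      · simp [h, hs]
      · simp [h]
    simp only [heq] at hsum
    calc ∑' i, Metric.ediam (U i) ^ s ≤ ∑' i, (Metric.ediam (t i) ^ s + δ i) :=
          ENNReal.tsum_le_tsum hUd
      _ = ∑' i, Metric.ediam (t i) ^ s + ∑' i, δ i := ENNReal.tsum_add
      _ < ((n : ℝ≥0∞)⁻¹ - ε) + ε := ENNReal.add_lt_add hsum hδs
      _ = (n : ℝ≥0∞)⁻¹ := tsub_add_cancel_of_le hεn.le
  · intro h
    choose U _ hUs hU using h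
    have hle : ∀ n i, Metric.ediam (U n i) ≤ ((n : ℝ≥0∞)⁻¹) ^ s⁻¹ := fun n i => by
      rw [ENNReal.le_rpow_inv_iff hs]
      exact (ENNReal.le_tsum i).trans (hUs n).le
    have hinv : Tendsto (fun n : ℕ => ((n : ℝ≥0∞)⁻¹)) atTop (𝓝 0) :=
      ENNReal.tendsto_inv_nat_nhds_zero
    have hr : Tendsto (fun n : ℕ => ((n : ℝ≥0∞)⁻¹) ^ s⁻¹) atTop (𝓝 0) := by
      have := (ENNReal.continuous_rpow_const (y := s⁻¹)).tendsto 0 |>.comp hinv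
      simpa [Function.comp_def, hs] using this
    have := Measure.hausdorffMeasure_le_liminf_tsum s A _ hr U (.of_forall hle) (.of_forall hU)
    refine le_antisymm (this.trans ?_) zero_le
    have hlim : Tendsto (fun n => ∑' i, Metric.ediam (U n i) ^ s) atTop (𝓝 0) :=
      tendsto_of_tendsto_of_tendsto_of_le_of_le tendsto_const_nhds hinv (fun _ => zero_le)
        fun n => (hUs n).le
    exact hlim.liminf_eq.le

theorem HyperUnit.isGδ_hausdorffMeasure_eq_zero {s : ℝ} (hs : 0 < s) :
    IsGδ {A : HyperUnit | μH[s] A.toSet = 0} := by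
  simp only [hausdorffMeasure_eq_zero_iff hs, ofPred_forall]
  refine .iInter_of_isOpen fun n => ?_
  simp only [ofPred_exists, ofPred_and]
  refine isOpen_iUnion fun U => ?_
  -- A family that is not open contributes the empty set.
  by_cases hU : ∀ i, IsOpen (U i)
  · exact isOpen_const.inter (isOpen_const.inter
      (HyperUnit.isOpen_toSet_subset (isOpen_iUnion hU)))
  · simp [hU]

theorem dimH_le_iff_forall_rat {X : Type*} [EMetricSpace X] [MeasurableSpace X] [BorelSpace X]
    {A : Set X} {r : ℝ≥0∞} :
    dimH A ≤ r ↔ ∀ q : ℚ, r < ENNReal.ofReal q → μH[(q : ℝ)] A = 0 := by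
  constructor
  · intro h q hq
    have hq0 : 0 < (q : ℝ) := ENNReal.ofReal_pos.1 (zero_le.trans_lt hq)
    have := hausdorffMeasure_of_dimH_lt (h.trans_lt hq)
    rwa [Real.coe_toNNReal _ hq0.le] at this
  · intro h
    by_contra! hlt
    obtain ⟨q, h₁, h₂⟩ := ENNReal.exists_rat_ofReal_btwn hlt
    have hq0 : 0 < (q : ℝ) := ENNReal.ofReal_pos.1 (zero_le.trans_lt h₁)
    have := hausdorffMeasure_of_lt_dimH h₂
    rw [Real.coe_toNNReal _ hq0.le, h q h₁] at this
    simp at this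

theorem HyperUnit.isGδ_hausdorffDim_le (r : ℝ≥0∞) :
    IsGδ {A : HyperUnit | A.hausdorffDim ≤ r} := by
  simp only [HyperUnit.hausdorffDim, dimH_le_iff_forall_rat, ofPred_forall]
  refine .iInter fun q => ?_
  by_cases hq : r < ENNReal.ofReal q
  · simpa [hq] using HyperUnit.isGδ_hausdorffMeasure_eq_zero
      (ENNReal.ofReal_pos.1 (zero_le.trans_lt hq))
  · simp [hq]

end Hausdorff

/-! ### Fourier dimension -/

section Fourier

theorem norm_fourierTransformMeasure_le_one (μ : Measure ℝ) [IsProbabilityMeasure μ] (x : ℝ) :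
    ‖fourierTransformMeasure μ x‖ ≤ 1 := by
  have := norm_integral_le_of_norm_le_const (μ := μ)
    (f := fun t : ℝ => Complex.exp (-(Complex.I * (x : ℂ) * (t : ℂ)))) (C := 1)
    (.of_forall fun t => by simp [Complex.norm_exp])
  simpa [fourierTransformMeasure] using this

/-- For `|x| ≥ 1` the powers compare; for `|x| ≤ 1` the trivial bound `1` suffices. -/
theorem FourierDecay.mono {A : Set ℝ} {s t : ℝ≥0} (h : FourierDecay A t) (hst : s ≤ t) :
    FourierDecay A s := by
  obtain ⟨μ, hμ, hA, c, hc, hdec⟩ := h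
  refine ⟨μ, hμ, hA, max c 1, by positivity, fun x hx => ?_⟩
  have hx0 : 0 < |x| := abs_pos.2 hx
  have hst' : (s : ℝ) ≤ t := hst
  rcases le_total 1 |x| with h1 | h1
  · refine (hdec x hx).trans ?_
    gcongr
    · exact le_max_left _ _
  · refine (norm_fourierTransformMeasure_le_one μ x).trans ?_
    have : 1 ≤ |x| ^ (-(s : ℝ) / 2) :=
      Real.one_le_rpow_of_pos_of_le_one_of_nonpos hx0 h1 (by
        rw [neg_div]
        exact neg_nonpos.2 (by positivity))
    nlinarith [le_max_right c 1]

theorem fourierTransformMeasure_map_val (ν : Measure (Icc (0 : ℝ) 1)) (x : ℝ) :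
    fourierTransformMeasure (ν.map (↑)) x =
      ∫ t : Icc (0 : ℝ) 1, Complex.exp (-(Complex.I * (x : ℂ) * ((t : ℝ) : ℂ))) ∂ν :=
  (MeasurableEmbedding.subtype_coe measurableSet_Icc).integral_map _

theorem continuous_fourierTransformMeasure_map_val (x : ℝ) :
    Continuous fun ν : ProbabilityMeasure (Icc (0 : ℝ) 1) =>
      fourierTransformMeasure ((ν : Measure (Icc (0 : ℝ) 1)).map Subtype.val) x := by
  simp only [fourierTransformMeasure_map_val]
  rw [continuous_iff_continuousAt]
  intro ν
  exact (ProbabilityMeasure.tendsto_iff_forall_integral_rclike_tendsto ℂ).1 tendsto_id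
    (BoundedContinuousFunction.mkOfCompact
      ⟨fun t : Icc (0 : ℝ) 1 => Complex.exp (-(Complex.I * (x : ℂ) * ((t : ℝ) : ℂ))),
        by fun_prop⟩)

/-- The relation "the probability measure `μ` is carried by the compact set `A`" is closed. -/
theorem isClosed_measure_compacts_eq_one {X : Type*} [MetricSpace X] [CompactSpace X]
    [MeasurableSpace X] [BorelSpace X] :
    IsClosed {p : Compacts X × ProbabilityMeasure X | (p.2 : Measure X) p.1 = 1} := by
  rw [← isOpen_compl_iff, isOpen_iff_mem_nhds]
  rintro ⟨A, μ⟩ h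
  have hpos : 0 < (μ : Measure X) (A : Set X)ᶜ := by
    rw [pos_iff_ne_zero]
    exact fun h0 => h ((prob_compl_eq_zero_iff A.isCompact.measurableSet).1 h0)
  -- Inner regularity yields a compact set of positive mass off `A`. Its neighbourhood `V` keeps
  -- positive mass for nearby measures (portmanteau), while nearby compacta stay in the disjoint
  -- `U`.
  obtain ⟨K, hKA, hK, hμK⟩ := A.isCompact.isClosed.isOpen_compl.measurableSet.exists_lt_isCompact hpos
  obtain ⟨U, V, hU, hV, hAU, hKV, hUV⟩ :=
    SeparatedNhds.of_isCompact_isCompact A.isCompact hK (subset_compl_iff_disjoint_left.1 hKA)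
  have hVμ : 0 < (μ : Measure X) V := hμK.trans_le (measure_mono hKV)
  have hnhds : ∀ᶠ ν : ProbabilityMeasure X in 𝓝 μ, 0 < (ν : Measure X) V :=
    lt_of_lt_of_le hVμ (ProbabilityMeasure.le_liminf_measure_open_of_tendsto tendsto_id hV)
      |> eventually_lt_of_lt_liminf
  have hnhds' : ∀ᶠ B : Compacts X in 𝓝 A, (B : Set X) ⊆ U :=
    (Compacts.isOpen_subsets_of_isOpen hU).mem_nhds hAU
  refine mem_of_superset (prod_mem_nhds hnhds' hnhds) ?_
  rintro ⟨B, ν⟩ ⟨hB, hν⟩ h1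
  have h0 := (prob_compl_eq_zero_iff B.isCompact.measurableSet).2 h1
  exact hν.ne' (measure_mono_null (fun x hxV hxB => hUV.le_bot ⟨hB hxB, hxV⟩) h0)

/-- Moves the measures to the compact space `[0,1]` and makes the constants countable. -/
theorem HyperUnit.fourierDecay_iff (A : HyperUnit) (s : ℝ≥0) :
    FourierDecay A.toSet s ↔ ∃ n : ℕ, ∃ ν : ProbabilityMeasure (Icc (0 : ℝ) 1),
      (ν : Measure (Icc (0 : ℝ) 1)) (A : Set (Icc (0 : ℝ) 1)) = 1 ∧ ∀ x : ℝ, x ≠ 0 →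
        ‖fourierTransformMeasure ((ν : Measure (Icc (0 : ℝ) 1)).map Subtype.val) x‖ ≤ n * |x| ^ (-(s : ℝ) / 2) := by
  have hemb : MeasurableEmbedding ((↑) : Icc (0 : ℝ) 1 → ℝ) :=
    .subtype_coe measurableSet_Icc
  constructor
  · rintro ⟨μ, hμ, hA, c, hc, hdec⟩
    have hAI : A.toSet ⊆ Icc 0 1 := by rintro _ ⟨x, -, rfl⟩; exact x.2
    have hI : μ (Icc 0 1) = 1 := le_antisymm prob_le_one (hA ▸ measure_mono hAI)
    have hmap : (μ.comap ((↑) : Icc (0 : ℝ) 1 → ℝ)).map (↑) = μ := by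
      rw [hemb.map_comap, Subtype.range_coe, Measure.restrict_eq_self_of_ae_mem]
      exact (prob_compl_eq_zero_iff measurableSet_Icc).2 hI
    have hp : IsProbabilityMeasure (μ.comap ((↑) : Icc (0 : ℝ) 1 → ℝ)) :=
      ⟨by rw [hemb.comap_apply, image_univ, Subtype.range_coe, hI]⟩
    obtain ⟨n, hn⟩ := exists_nat_ge c
    refine ⟨n, ⟨_, hp⟩, ?_, fun x hx => ?_⟩
    · rw [ProbabilityMeasure.coe_mk, hemb.comap_apply]
      exact hA
    · rw [ProbabilityMeasure.coe_mk, hmap]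
      refine (hdec x hx).trans ?_
      gcongr
  · rintro ⟨n, ν, hA, hdec⟩
    refine ⟨(ν : Measure (Icc (0 : ℝ) 1)).map Subtype.val, Measure.isProbabilityMeasure_map hemb.measurable.aemeasurable,
      -- `n` may be zero, while the constant must be positive.
      ?_, n + 1, by positivity, fun x hx => (hdec x hx).trans ?_⟩
    · rw [hemb.map_apply, HyperUnit.toSet, preimage_image_eq _ Subtype.val_injective, hA]
    · gcongr
      linarith

theorem HyperUnit.isGδ_not_fourierDecay (s : ℝ≥0) :
    IsGδ {A : HyperUnit | ¬ FourierDecay A.toSet s} := by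
  simp only [HyperUnit.fourierDecay_iff, not_exists, ofPred_forall]
  refine .iInter_of_isOpen fun n => ?_
  have hcl : IsClosed {p : HyperUnit × ProbabilityMeasure (Icc (0 : ℝ) 1) |
      (p.2 : Measure (Icc (0 : ℝ) 1)) (p.1 : Set (Icc (0 : ℝ) 1)) = 1 ∧ ∀ x : ℝ, x ≠ 0 →
        ‖fourierTransformMeasure ((p.2 : Measure (Icc (0 : ℝ) 1)).map Subtype.val) x‖ ≤
          n * |x| ^ (-(s : ℝ) / 2)} := by
    simp only [ofPred_and, ofPred_forall]
    exact isClosed_measure_compacts_eq_one.inter <|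
      isClosed_iInter fun x => isClosed_iInter fun _ => isClosed_le
        ((continuous_fourierTransformMeasure_map_val x).comp continuous_snd).norm continuous_const
  -- Compactness of the space of probability measures enters here.
  have hfst := isClosedMap_fst_of_compactSpace _ hcl
  convert hfst.isOpen_compl using 1
  ext A
  simp

theorem fourierDim_le_iff_forall_rat {A : Set ℝ} {r : ℝ≥0∞} :
    fourierDim A ≤ r ↔ ∀ q : ℚ, r < ENNReal.ofReal q → (q : ℝ) ≤ 1 →
      ¬ FourierDecay A (q : ℝ).toNNReal := by
  simp only [fourierDim, iSup_le_iff, and_imp]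
  constructor
  · intro h q hq hq1 hd
    exact (h _ (Real.toNNReal_le_one.2 hq1) hd).not_gt hq
  · intro h s hs1 hd
    by_contra! hlt
    obtain ⟨q, h₁, h₂⟩ := ENNReal.exists_rat_ofReal_btwn hlt
    have hqs : (q : ℝ).toNNReal < s := ENNReal.coe_lt_coe.1 h₂
    exact h q h₁ (Real.toNNReal_le_one.1 (hqs.le.trans hs1)) (hd.mono hqs.le)

theorem HyperUnit.isGδ_fourierDim_le (r : ℝ≥0∞) :
    IsGδ {A : HyperUnit | A.fourierDim ≤ r} := by
  simp only [HyperUnit.fourierDim, fourierDim_le_iff_forall_rat, ofPred_forall]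
  exact .iInter fun q => .iInter fun _ => .iInter fun _ => HyperUnit.isGδ_not_fourierDecay _

end Fourier

theorem mainTheorem12 :
    -- the Hausdorff dimension
    BorelSigma 2 {q : HyperUnit × Set.Icc (0 : ℝ) 1 |
      ENNReal.ofReal (q.2 : ℝ) < q.1.hausdorffDim} ∧
    BorelPi 3 {q : HyperUnit × Set.Icc (0 : ℝ) 1 |
      ENNReal.ofReal (q.2 : ℝ) ≤ q.1.hausdorffDim} ∧
    -- the Fourier dimension
    BorelSigma 2 {q : HyperUnit × Set.Icc (0 : ℝ) 1 |
      ENNReal.ofReal (q.2 : ℝ) < q.1.fourierDim} ∧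
    BorelPi 3 {q : HyperUnit × Set.Icc (0 : ℝ) 1 |
      ENNReal.ofReal (q.2 : ℝ) ≤ q.1.fourierDim} ∧
    -- closed Salem sets
    BorelPi 3 salemSets ∧
    BorelSigma 2 {q : salemSets × Set.Icc (0 : ℝ) 1 |
      ENNReal.ofReal (q.2 : ℝ) < salemDim q.1} ∧
    BorelPi 3 {q : salemSets × Set.Icc (0 : ℝ) 1 |
      ENNReal.ofReal (q.2 : ℝ) ≤ salemDim q.1} := by
  have hg : Continuous fun p : Icc (0 : ℝ) 1 => ENNReal.ofReal (p : ℝ) :=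
    ENNReal.continuous_ofReal.comp continuous_subtype_val
  have hH := HyperUnit.isGδ_hausdorffDim_le
  have hF := HyperUnit.isGδ_fourierDim_le
  have hS : ∀ r, IsGδ {A : salemSets | salemDim A ≤ r} := fun r =>
    IsGδ.preimage (f := Subtype.val) continuous_subtype_val (hH r)
  exact ⟨borelSigma_two_lt hH hg, borelPi_three_le hH hg, borelSigma_two_lt hF hg,
    borelPi_three_le hF hg, borelPi_three_eq hH hF, borelSigma_two_lt hS hg,
    borelPi_three_le hS hg⟩
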